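/- Let $n \ge 0$, $C_0 \ge 10$, $k > 1$, $k_0 \ge 1$ and $\delta > 0$. There is a finite constant $C$, depending only on $n, C_0, k, k_0, \delta$, with the following property. Let $\mu$ be a Borel measure on $\mathbb{R}^n$ such that $\mu(B(0,2)) \ge 1$, $\mu(\mathbb{R}^n \setminus B(0,2)) = 0$, and $\mu(B(x,t)) \le 2 C_0 t$ for all $x \in \mathbb{R}^n$, $t>0$, where $B(x,t)$ denotes the closed ball. For $x \in \mathbb{R}^n$ and $t > 0$ put $$\delta(x,t) = \frac{\mu(B(x,t))}{t}, \qquad \tilde\delta(x,t) = \sup_{y \in B(x,k_0t)} \delta(y,t), \qquad \beta_1(x,t) = \inf_D \frac1t \int_{B(x,kt)} \frac{d(y,D)}{t}\, d\mu(y),$$ the infimum being taken over all lines $D$ of $\mathbb{R}^n$, and let $$c^2(\mu) = \iiint c(x,y,z)^2 \, d\mu(x)\, d\mu(y)\, d\mu(z) \in [0,\infty],$$ where $c(x,y,z)$ is the Menger curvature, that is, the inverse of the radius of the circle through $x,y,z$ (and $0$ if the three points are collinear or not distinct). Then $$\int \int_0^\infty \beta_1(x,t)^2\, \mathbb{1}_{\{\delta(x,t)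 \ge \delta\}} \, \frac{dt}{t}\, d\mu(x) \le C\, c^2(\mu),$$ and, with the same constant, also $$\int \int_0^\infty \beta_1(x,t)^2\, \mathbb{1}_{\{\tilde\delta(x,t) \ge \delta\}} \, \frac{dt}{t}\, d\mu(x) \le C\, c^2(\mu).$$ -/

import Mathlib

open MeasureTheory Set

noncomputable section

namespace Menger

/-- The Menger curvature `c(x, y, z)` of three points of `ℝⁿ`: the inverse of the radius of the
circle through them when they are vertices of a nondegenerate triangle, and `0` when they are
collinear (the circle being then a line, of infinite radius). For triples in which two points
coincide, where no circle is determined, the value is set to `0`. -/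
def curvature {n : ℕ} (x y z : EuclideanSpace ℝ (Fin n)) : ℝ :=
  open Classical in
  if h : AffineIndependent ℝ ![x, y, z] then
    (Affine.Simplex.circumradius (⟨![x, y, z], h⟩ : Affine.Triangle ℝ (EuclideanSpace ℝ (Fin n))))⁻¹
  else 0

/-- The squared total Menger curvature `c²(μ) = ∫∫∫ c(x, y, z)² dμ(x) dμ(y) dμ(z)`, a number in
`[0, ∞]`. -/
def totalCurvatureSq {n : ℕ} (μ : Measure (EuclideanSpace ℝ (Fin n))) : ENNReal :=
  ∫⁻ x, ∫⁻ y, ∫⁻ z, ENNReal.ofReal (curvature x y z ^ 2) ∂μ ∂μ ∂μ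

/-- The density `δ(x, t) = μ(B(x, t)) / t`; all balls are closed. -/
def density {n : ℕ} (μ : Measure (EuclideanSpace ℝ (Fin n)))
    (x : EuclideanSpace ℝ (Fin n)) (t : ℝ) : ENNReal :=
  μ (Metric.closedBall x t) / ENNReal.ofReal t

/-- The enlarged density: the supremum of `δ(y, t)` over `y ∈ B(x, k₀ t)`. -/
def maxDensity {n : ℕ} (μ : Measure (EuclideanSpace ℝ (Fin n))) (k₀ : ℝ)
    (x : EuclideanSpace ℝ (Fin n)) (t : ℝ) : ENNReal :=
  ⨆ y ∈ Metric.closedBall x (k₀ * t), density μ y t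

/-- `D` is a line: a one-dimensional affine subspace. -/
def IsLine {n : ℕ} (D : AffineSubspace ℝ (EuclideanSpace ℝ (Fin n))) : Prop :=
  Module.finrank ℝ D.direction = 1

/-- `β₁^D(x, t) = (1/t) ∫_{B(x, kt)} d(y, D)/t dμ(y)`. -/
def betaOneLine {n : ℕ} (μ : Measure (EuclideanSpace ℝ (Fin n))) (k : ℝ)
    (D : AffineSubspace ℝ (EuclideanSpace ℝ (Fin n)))
    (x : EuclideanSpace ℝ (Fin n)) (t : ℝ) : ENNReal :=
  (∫⁻ y in Metric.closedBall x (k * t),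
    ENNReal.ofReal (Metric.infDist y (D : Set (EuclideanSpace ℝ (Fin n))) / t) ∂μ)
      / ENNReal.ofReal t

/-- Jones' number `β₁(x, t)`: the infimum of `β₁^D(x, t)` over all lines `D`. -/
def betaOne {n : ℕ} (μ : Measure (EuclideanSpace ℝ (Fin n))) (k : ℝ)
    (x : EuclideanSpace ℝ (Fin n)) (t : ℝ) : ENNReal :=
  ⨅ (D : AffineSubspace ℝ (EuclideanSpace ℝ (Fin n))) (_ : IsLine D), betaOneLine μ k D x t

end Menger

end

namespace Menger

open InnerProductGeometry EuclideanGeometry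

variable {n : ℕ}

/-! Curvature measures distance to lines: `d(z, ab) = c(a, b, z) |z - a| |z - b| / 2`. So for `a`,
`b` within `K t` of `x`, Cauchy–Schwarz bounds `β₁(x, t)²` by a constant times `t ∫ c(a, b, z)²
dμ(z)` (`betaOneLine_sq_le`).

If some `B(y, t)` near `x` is heavy, linear growth prevents its mass from concentrating in a ball of
radius `c t`, so the pairs `(a, b)` in it with `|a - b| > c t` have product measure at least of
order `t²` (`le_prod_separated`). Averaging over them gives `betaOne_sq_le`.

Integrating in `x` and `t`, Tonelli leaves a bounded weight on each pair: it is counted only at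
scales `t` comparable to `|a - b|` (`lintegral_separatedPairs_le`). -/

lemma curvature_eq (x y z : EuclideanSpace ℝ (Fin n)) :
    curvature x y z = 2 * √(inner ℝ (y - x) (y - x) * inner ℝ (z - x) (z - x)
        - inner ℝ (y - x) (z - x) * inner ℝ (y - x) (z - x))
      / (‖y - x‖ * ‖z - x‖ * ‖y - z‖) := by
  classical
  unfold curvature
  split_ifs with h
  · have hyx : y ≠ x := by
      have := h.injective.ne (show (1 : Fin 3) ≠ 0 by decide); simpa using this
    have hzx : z ≠ x := by
      have := h.injective.ne (show (2 : Fin 3) ≠ 0 by decide); simpa using this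
    have hyz : y ≠ z := by
      have := h.injective.ne (show (1 : Fin 3) ≠ 2 by decide); simpa using this
    -- Law of sines at `x`; the square root in the formula is `‖y - x‖ ‖z - x‖` times the sine of
    -- that angle.
    have key := Affine.Triangle.dist_div_sin_angle_eq_two_mul_circumradius
      (⟨![x, y, z], h⟩ : Affine.Triangle ℝ (EuclideanSpace ℝ (Fin n)))
      (i₁ := 1) (i₂ := 0) (i₃ := 2) (by decide) (by decide) (by decide)
    simp only [Matrix.cons_val_zero, Matrix.cons_val_one, Matrix.cons_val] at key
    have hs := sin_angle_mul_norm_mul_norm (y - x) (z - x)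
    rw [← hs]
    have h1 : ‖y - x‖ ≠ 0 := by simpa [sub_eq_zero] using hyx
    have h2 : ‖z - x‖ ≠ 0 := by simpa [sub_eq_zero] using hzx
    have h3 : ‖y - z‖ ≠ 0 := by simpa [sub_eq_zero] using hyz
    rw [EuclideanGeometry.angle, dist_eq_norm] at key
    simp only [vsub_eq_sub] at key
    rw [show ∀ r : ℝ, r⁻¹ = 2 * (2 * r)⁻¹ from fun r => by rw [mul_inv]; ring, ← key, inv_div]
    field_simp
  -- Coincident points are collinear too: the Gram determinant vanishes in every degenerate case.
  · have hc : Collinear ℝ {x, y, z} := by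
      rw [affineIndependent_iff_not_collinear_set, not_not] at h; exact h
    obtain ⟨w, hw⟩ := (collinear_iff_of_mem (p₀ := x) (by simp)).1 hc
    obtain ⟨a, rfl⟩ := hw y (by simp)
    obtain ⟨b, rfl⟩ := hw z (by simp)
    simp only [vadd_eq_add, add_sub_cancel_right, real_inner_smul_left, real_inner_smul_right]
    rw [show a * (a * inner ℝ w w) * (b * (b * inner ℝ w w))
      - b * (a * inner ℝ w w) * (b * (a * inner ℝ w w)) = 0 by ring]
    simp

lemma curvature_nonneg (x y z : EuclideanSpace ℝ (Fin n)) : 0 ≤ curvature x y z := by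
  rw [curvature_eq]; positivity

lemma measurable_curvature : Measurable
    fun p : EuclideanSpace ℝ (Fin n) × EuclideanSpace ℝ (Fin n) × EuclideanSpace ℝ (Fin n) =>
      curvature p.1 p.2.1 p.2.2 := by
  simp only [curvature_eq]
  refine Measurable.div ?_ ?_
  · exact Continuous.measurable (by fun_prop)
  · exact Continuous.measurable (by fun_prop)

/-- The Gram determinant is the squared base times the squared height. The competitor on the line is
the foot of the perpendicular from `z`, with parameter `s`. -/
lemma infDist_line_le (x y z : EuclideanSpace ℝ (Fin n)) (hxy : x ≠ y) :
    Metric.infDist z (line[ℝ, x, y] : Set (EuclideanSpace ℝ (Fin n)))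
      ≤ curvature x y z * ‖z - x‖ * ‖y - z‖ / 2 := by
  set u := y - x with hu
  set v := z - x with hv
  have hu0 : ‖u‖ ≠ 0 := by simpa [hu, sub_eq_zero] using hxy.symm
  set s : ℝ := inner ℝ u v / inner ℝ u u with hs
  set G : ℝ := inner ℝ u u * inner ℝ v v - inner ℝ u v * inner ℝ u v with hG
  have huu : inner ℝ u u = ‖u‖ ^ 2 := real_inner_self_eq_norm_sq u
  have hmem : AffineMap.lineMap x y s ∈ (line[ℝ, x, y] : Set (EuclideanSpace ℝ (Fin n))) :=
    AffineMap.lineMap_mem_affineSpan_pair s x y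
  have h1 : Metric.infDist z (line[ℝ, x, y] : Set (EuclideanSpace ℝ (Fin n))) ≤ ‖v - s • u‖ := by
    refine (Metric.infDist_le_dist_of_mem hmem).trans_eq ?_
    rw [dist_eq_norm, AffineMap.lineMap_apply, vsub_eq_sub, vadd_eq_add, hv, hu]
    congr 1; abel
  have h2 : ‖v - s • u‖ = √G / ‖u‖ := by
    have hsq : ‖v - s • u‖ ^ 2 = G / ‖u‖ ^ 2 := by
      rw [norm_sub_sq_real, real_inner_smul_right, norm_smul, mul_pow, Real.norm_eq_abs, sq_abs,
        real_inner_comm u v, hG, hs, huu, real_inner_self_eq_norm_sq v]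
      field_simp
      ring
    rw [← Real.sqrt_sq (norm_nonneg (v - s • u)), hsq, Real.sqrt_div' _ (sq_nonneg _),
      Real.sqrt_sq (norm_nonneg _)]
  refine h1.trans ?_
  rw [h2, curvature_eq, ← hu, ← hv, ← hG]
  rcases eq_or_ne v 0 with h | h
  · have : G = 0 := by rw [hG, h]; simp
    rw [this]; simp
  rcases eq_or_ne y z with h' | h'
  · have : G = 0 := by rw [hG, show v = u by rw [hv, hu, h']]; ring
    rw [this]; simp
  have hv0 : ‖v‖ ≠ 0 := by simpa using h
  have hyz : ‖y - z‖ ≠ 0 := by simpa [sub_eq_zero] using h'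
  apply le_of_eq
  field_simp

lemma isLine_line {x y : EuclideanSpace ℝ (Fin n)} (hxy : x ≠ y) : IsLine line[ℝ, x, y] := by
  rw [IsLine, direction_affineSpan, vectorSpan_pair]
  exact finrank_span_singleton (by simpa [sub_eq_zero] using hxy)

lemma sq_setLIntegral_le {α : Type*} [MeasurableSpace α] (μ : Measure α) (B : Set α)
    {f : α → ENNReal} (hf : Measurable f) :
    (∫⁻ x in B, f x ∂μ) ^ 2 ≤ μ B * ∫⁻ x in B, f x ^ 2 ∂μ := by
  have h := ENNReal.lintegral_mul_le_Lp_mul_Lq (μ.restrict B) Real.HolderConjugate.two_two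
    hf.aemeasurable (measurable_const (a := (1 : ENNReal))).aemeasurable
  simp only [Pi.mul_apply, mul_one, ENNReal.rpow_ofNat] at h
  refine (pow_le_pow_left₀ zero_le h 2).trans_eq ?_
  rw [mul_pow, ← ENNReal.rpow_mul_natCast, ← ENNReal.rpow_mul_natCast]
  norm_num [mul_comm]

/-! ### Pointwise control of `β₁` by curvature. -/

lemma betaOneLine_sq_le {μ : Measure (EuclideanSpace ℝ (Fin n))} {k K M t : ℝ}
    {x a b : EuclideanSpace ℝ (Fin n)} (ht : 0 < t) (hkK : k ≤ K) (hK : 0 < K)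
    (hμ : μ (Metric.closedBall x (k * t)) ≤ ENNReal.ofReal (M * t))
    (ha : dist a x ≤ K * t) (hb : dist b x ≤ K * t) (hab : a ≠ b) :
    betaOneLine μ k line[ℝ, a, b] x t ^ 2 ≤ ENNReal.ofReal (4 * K ^ 4 * M * t) *
      ∫⁻ z, ENNReal.ofReal (curvature a b z ^ 2) ∂μ := by
  have hmeas : Measurable fun z => ENNReal.ofReal (curvature a b z) := by
    have := (measurable_curvature (n := n)).comp
      ((measurable_const (a := a)).prodMk ((measurable_const (a := b)).prodMk measurable_id))
    exact this.ennreal_ofReal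
  have hpt : ∀ z ∈ Metric.closedBall x (k * t),
      ENNReal.ofReal (Metric.infDist z (line[ℝ, a, b] : Set (EuclideanSpace ℝ (Fin n))) / t) ≤
        ENNReal.ofReal (2 * K ^ 2 * t) * ENNReal.ofReal (curvature a b z) := by
    intro z hz
    rw [← ENNReal.ofReal_mul (by positivity)]
    apply ENNReal.ofReal_le_ofReal
    rw [div_le_iff₀ ht]
    have hzx : dist z x ≤ K * t := (Metric.mem_closedBall.1 hz).trans (by gcongr)
    have h1 : ‖z - a‖ ≤ 2 * K * t := by
      rw [← dist_eq_norm]; linarith [dist_triangle_right z a x]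
    have h2 : ‖b - z‖ ≤ 2 * K * t := by
      rw [← dist_eq_norm]; linarith [dist_triangle_right b z x]
    have h0 := curvature_nonneg a b z
    calc _ ≤ curvature a b z * ‖z - a‖ * ‖b - z‖ / 2 := infDist_line_le a b z hab
      _ ≤ curvature a b z * (2 * K * t) * (2 * K * t) / 2 := by gcongr
      _ = _ := by ring
  have hint : betaOneLine μ k line[ℝ, a, b] x t ≤ ENNReal.ofReal (2 * K ^ 2) *
      ∫⁻ z in Metric.closedBall x (k * t), ENNReal.ofReal (curvature a b z) ∂μ := by
    rw [betaOneLine]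
    refine ENNReal.div_le_of_le_mul ?_
    refine (setLIntegral_mono' Metric.isClosed_closedBall.measurableSet hpt).trans_eq ?_
    rw [lintegral_const_mul _ hmeas, ENNReal.ofReal_mul (by positivity)]
    ring
  calc _ ≤ _ := pow_le_pow_left₀ zero_le hint 2
    _ = ENNReal.ofReal (2 * K ^ 2) ^ 2 * (∫⁻ z in Metric.closedBall x (k * t),
          ENNReal.ofReal (curvature a b z) ∂μ) ^ 2 := mul_pow _ _ _
    _ ≤ ENNReal.ofReal (2 * K ^ 2) ^ 2 * (ENNReal.ofReal (M * t) *
          ∫⁻ z, ENNReal.ofReal (curvature a b z ^ 2) ∂μ) := by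
      gcongr
      refine (sq_setLIntegral_le μ _ hmeas).trans ?_
      gcongr
      · exact Measure.restrict_le_self
      · exact (ENNReal.ofReal_pow (curvature_nonneg _ _ _) _).ge
    _ = _ := by
      rw [← mul_assoc, ← ENNReal.ofReal_pow (by positivity), ← ENNReal.ofReal_mul (by positivity)]
      congr 2; ring

/-- Pairs of points at distance at most `K t` from `x` and at mutual distance at least `c t`. -/
def separatedPairs (K c : ℝ) (x : EuclideanSpace ℝ (Fin n)) (t : ℝ) :
    Set (EuclideanSpace ℝ (Fin n) × EuclideanSpace ℝ (Fin n)) :=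
  {p | dist p.1 x ≤ K * t ∧ dist p.2 x ≤ K * t ∧ c * t ≤ dist p.1 p.2}

lemma measurableSet_separated (y : EuclideanSpace ℝ (Fin n)) (t r : ℝ) :
    MeasurableSet {p : EuclideanSpace ℝ (Fin n) × EuclideanSpace ℝ (Fin n) |
      dist p.1 y ≤ t ∧ dist p.2 y ≤ t ∧ r < dist p.1 p.2} := by
  simp only [Set.ofPred_and]
  exact (measurableSet_le (by fun_prop) (by fun_prop)).inter
    ((measurableSet_le (by fun_prop) (by fun_prop)).inter
      (measurableSet_lt (by fun_prop) (by fun_prop)))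

/-- A ball of large measure carries many pairs of well separated points. -/
lemma le_prod_separated {μ : Measure (EuclideanSpace ℝ (Fin n))} [SFinite μ] {c η t : ℝ}
    {y : EuclideanSpace ℝ (Fin n)} (hη : 0 < η) (ht : 0 < t)
    (hsmall : ∀ a, μ (Metric.closedBall a (c * t)) ≤ ENNReal.ofReal (η * t / 2))
    (hy : ENNReal.ofReal (η * t) ≤ μ (Metric.closedBall y t)) :
    ENNReal.ofReal (η ^ 2 * t ^ 2 / 2) ≤ (μ.prod μ)
      {p | dist p.1 y ≤ t ∧ dist p.2 y ≤ t ∧ c * t < dist p.1 p.2} := by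
  rw [Measure.prod_apply (measurableSet_separated y t (c * t))]
  -- Removing the small ball around `a` costs at most half of the mass `η t`.
  have hslice : ∀ a ∈ Metric.closedBall y t, ENNReal.ofReal (η * t / 2) ≤
      μ (Prod.mk a ⁻¹' {p | dist p.1 y ≤ t ∧ dist p.2 y ≤ t ∧ c * t < dist p.1 p.2}) := by
    intro a ha
    have hsub : Metric.closedBall y t \ Metric.closedBall a (c * t) ⊆
        Prod.mk a ⁻¹' {p | dist p.1 y ≤ t ∧ dist p.2 y ≤ t ∧ c * t < dist p.1 p.2} := by
      rintro b ⟨hb, hb'⟩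
      rw [Metric.mem_closedBall, not_le, dist_comm] at hb'
      exact ⟨ha, hb, hb'⟩
    calc ENNReal.ofReal (η * t / 2) = ENNReal.ofReal (η * t) - ENNReal.ofReal (η * t / 2) := by
          rw [← ENNReal.ofReal_sub _ (by positivity)]; congr 1; ring
      _ ≤ μ (Metric.closedBall y t) - μ (Metric.closedBall a (c * t)) :=
          tsub_le_tsub hy (hsmall a)
      _ ≤ μ (Metric.closedBall y t \ Metric.closedBall a (c * t)) := le_measure_sdiff
      _ ≤ _ := measure_mono hsub
  calc ENNReal.ofReal (η ^ 2 * t ^ 2 / 2)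
      = ENNReal.ofReal (η * t / 2) * ENNReal.ofReal (η * t) := by
        rw [← ENNReal.ofReal_mul (by positivity)]; congr 1; ring
    _ ≤ ENNReal.ofReal (η * t / 2) * μ (Metric.closedBall y t) := by gcongr
    _ = ∫⁻ _ in Metric.closedBall y t, ENNReal.ofReal (η * t / 2) ∂μ := by
        rw [setLIntegral_const]
    _ ≤ _ := setLIntegral_mono' Metric.isClosed_closedBall.measurableSet hslice
    _ ≤ _ := setLIntegral_le_lintegral _ _

lemma betaOne_sq_le {μ : Measure (EuclideanSpace ℝ (Fin n))} [SFinite μ] {k K M k₀ c η t : ℝ}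
    {x y : EuclideanSpace ℝ (Fin n)} (ht : 0 < t) (hkK : k ≤ K) (hk₀K : k₀ + 1 ≤ K) (hK : 0 < K)
    (hc : 0 < c) (hη : 0 < η)
    (hμ : μ (Metric.closedBall x (k * t)) ≤ ENNReal.ofReal (M * t))
    (hsmall : ∀ a, μ (Metric.closedBall a (c * t)) ≤ ENNReal.ofReal (η * t / 2))
    (hyx : dist y x ≤ k₀ * t) (hy : ENNReal.ofReal (η * t) ≤ μ (Metric.closedBall y t)) :
    betaOne μ k x t ^ 2 ≤ ENNReal.ofReal (8 * K ^ 4 * M / η ^ 2 / t) *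
      ∫⁻ p, (separatedPairs K c x t).indicator
        (fun p => ∫⁻ z, ENNReal.ofReal (curvature p.1 p.2 z ^ 2) ∂μ) p ∂(μ.prod μ) := by
  set Q : EuclideanSpace ℝ (Fin n) × EuclideanSpace ℝ (Fin n) → ENNReal :=
    fun p => ∫⁻ z, ENNReal.ofReal (curvature p.1 p.2 z ^ 2) ∂μ with hQ
  set P : Set (EuclideanSpace ℝ (Fin n) × EuclideanSpace ℝ (Fin n)) :=
    {p | dist p.1 y ≤ t ∧ dist p.2 y ≤ t ∧ c * t < dist p.1 p.2} with hP
  have hPm : MeasurableSet P := measurableSet_separated y t (c * t)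
  have hnear : ∀ a, dist a y ≤ t → dist a x ≤ K * t := by
    intro a ha
    have := dist_triangle a y x
    nlinarith
  -- Enlarging `P` removes the dependence on `y`, chosen without any measurability in `(x, t)`.
  have hPS : P ⊆ separatedPairs K c x t := fun p hp =>
    ⟨hnear _ hp.1, hnear _ hp.2.1, hp.2.2.le⟩
  have hcst : ENNReal.ofReal (4 * K ^ 4 * M * t) ≠ ⊤ := ENNReal.ofReal_ne_top
  have hpt : ∀ p ∈ P, betaOne μ k x t ^ 2 ≤ ENNReal.ofReal (4 * K ^ 4 * M * t) * Q p := by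
    intro p hp
    have hne : p.1 ≠ p.2 := dist_pos.1 ((mul_pos hc ht).trans hp.2.2)
    refine (pow_le_pow_left₀ zero_le ?_ 2).trans
      (betaOneLine_sq_le ht hkK hK hμ (hnear _ hp.1) (hnear _ hp.2.1) hne)
    exact iInf₂_le _ (isLine_line hne)
  have hmain : betaOne μ k x t ^ 2 * ENNReal.ofReal (η ^ 2 * t ^ 2 / 2) ≤
      ENNReal.ofReal (4 * K ^ 4 * M * t) * ∫⁻ p, (separatedPairs K c x t).indicator Q p
        ∂(μ.prod μ) := by
    calc _ ≤ betaOne μ k x t ^ 2 * (μ.prod μ) P := by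
          gcongr; exact le_prod_separated hη ht hsmall hy
      _ = ∫⁻ _ in P, betaOne μ k x t ^ 2 ∂(μ.prod μ) := by rw [setLIntegral_const]
      _ ≤ ∫⁻ p in P, ENNReal.ofReal (4 * K ^ 4 * M * t) * Q p ∂(μ.prod μ) :=
          setLIntegral_mono' hPm hpt
      _ = ENNReal.ofReal (4 * K ^ 4 * M * t) * ∫⁻ p, P.indicator Q p ∂(μ.prod μ) := by
          rw [lintegral_const_mul' _ _ hcst, lintegral_indicator hPm]
      _ ≤ _ := by
          gcongr
  have hpos : 0 < η ^ 2 * t ^ 2 / 2 := by positivity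
  rw [← ENNReal.le_div_iff_mul_le (.inl (by simpa using hpos)) (.inl ENNReal.ofReal_ne_top)] at hmain
  refine hmain.trans_eq ?_
  rw [mul_comm, mul_div_assoc, ← ENNReal.ofReal_div_of_pos hpos, mul_comm]
  congr 2
  field_simp
  ring

/-! ### Integration over centres and scales. -/

lemma lintegral_separatedPairs_le {μ : Measure (EuclideanSpace ℝ (Fin n))} [SFinite μ]
    {K L c : ℝ} (hK : 0 < K) (hL : 0 ≤ L) (hc : 0 < c)
    (hμ : ∀ (x : EuclideanSpace ℝ (Fin n)) (t : ℝ), 0 < t →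
        μ (Metric.closedBall x t) ≤ ENNReal.ofReal (L * t))
    (p : EuclideanSpace ℝ (Fin n) × EuclideanSpace ℝ (Fin n)) :
    ∫⁻ t in Ioi (0 : ℝ), ∫⁻ x, ENNReal.ofReal (1 / t ^ 2) *
      (separatedPairs K c x t).indicator 1 p ∂μ ≤ ENNReal.ofReal (2 * L * K ^ 2 / c) := by
  set d := dist p.1 p.2 with hd
  have hd0 : 0 ≤ d := dist_nonneg
  have hpt : ∀ t ∈ Ioi (0 : ℝ), ∫⁻ x, ENNReal.ofReal (1 / t ^ 2) *
      (separatedPairs K c x t).indicator 1 p ∂μ ≤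
      (Ioc 0 (d / c)).indicator (fun _ => ENNReal.ofReal (2 * L * K ^ 2 / d)) t := by
    intro t ht
    have ht : 0 < t := ht
    rw [lintegral_const_mul' _ _ ENNReal.ofReal_ne_top]
    -- Only these scales contribute. There the `x`-integral is at most `L K / t`, and `1 / t ≤ 2 K /
    -- d` avoids a logarithm.
    by_cases h : c * t ≤ d ∧ d ≤ 2 * K * t
    · have hdpos : 0 < d := (mul_pos hc ht).trans_le h.1
      have hmem : t ∈ Ioc 0 (d / c) := ⟨ht, by rw [le_div_iff₀ hc]; linarith [h.1]⟩
      rw [indicator_of_mem hmem]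
      have h1 : ∫⁻ x, (separatedPairs K c x t).indicator 1 p ∂μ ≤ ENNReal.ofReal (L * (K * t)) := by
        refine le_trans ?_ (hμ p.1 (K * t) (by positivity))
        rw [← lintegral_indicator_one Metric.isClosed_closedBall.measurableSet]
        refine lintegral_mono fun x => ?_
        by_cases hp : p ∈ separatedPairs K c x t
        · have hx : x ∈ Metric.closedBall p.1 (K * t) := by
            rw [Metric.mem_closedBall, dist_comm]; exact hp.1
          simp [hp, hx]
        · simp [hp]
      refine (mul_le_mul_right h1 _).trans ?_
      rw [← ENNReal.ofReal_mul (by positivity)]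
      apply ENNReal.ofReal_le_ofReal
      rw [le_div_iff₀ hdpos, div_mul_eq_mul_div, div_mul_eq_mul_div, div_le_iff₀ (by positivity)]
      have : 0 ≤ L * K * t := by positivity
      nlinarith [mul_le_mul_of_nonneg_left h.2 this]
    · refine le_trans (le_of_eq ?_) zero_le
      rw [mul_eq_zero]; right
      rw [lintegral_eq_zero_of_ae_eq_zero]
      refine .of_forall fun x => indicator_of_notMem (fun hp => h ⟨hp.2.2, ?_⟩) _
      have := dist_triangle_right p.1 p.2 x
      linarith [hp.1, hp.2.1]
  refine (setLIntegral_mono' measurableSet_Ioi hpt).trans ?_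
  refine (setLIntegral_le_lintegral _ _).trans ?_
  rw [lintegral_indicator_const measurableSet_Ioc, Real.volume_Ioc, sub_zero,
    ← ENNReal.ofReal_mul (by positivity)]
  apply ENNReal.ofReal_le_ofReal
  rcases hd0.eq_or_lt with h | h
  · rw [← h]; simp; positivity
  · apply le_of_eq; field_simp

lemma measurable_separatedPairs (K c : ℝ) : MeasurableSet
    {w : (EuclideanSpace ℝ (Fin n) × ℝ) × (EuclideanSpace ℝ (Fin n) × EuclideanSpace ℝ (Fin n)) |
      w.2 ∈ separatedPairs K c w.1.1 w.1.2} := by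
  simp only [separatedPairs, Set.ofPred_and]
  exact (measurableSet_le (by fun_prop) (by fun_prop)).inter
    ((measurableSet_le (by fun_prop) (by fun_prop)).inter
      (measurableSet_le (by fun_prop) (by fun_prop)))

lemma measurable_lintegral_curvature (μ : Measure (EuclideanSpace ℝ (Fin n))) [SFinite μ] :
    Measurable fun p : EuclideanSpace ℝ (Fin n) × EuclideanSpace ℝ (Fin n) =>
      ∫⁻ z, ENNReal.ofReal (curvature p.1 p.2 z ^ 2) ∂μ := by
  have h : Measurable fun q : (EuclideanSpace ℝ (Fin n) × EuclideanSpace ℝ (Fin n)) ×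
      EuclideanSpace ℝ (Fin n) => ENNReal.ofReal (curvature q.1.1 q.1.2 q.2 ^ 2) := by
    have hg : Measurable fun q : (EuclideanSpace ℝ (Fin n) × EuclideanSpace ℝ (Fin n)) ×
      EuclideanSpace ℝ (Fin n) => (q.1.1, q.1.2, q.2) := by fun_prop
    exact ((measurable_curvature.comp hg).pow_const 2).ennreal_ofReal
  exact h.lintegral_prod_right'

lemma lintegral_lintegral_separatedPairs_le {μ : Measure (EuclideanSpace ℝ (Fin n))} [SFinite μ]
    {K L c : ℝ} (hK : 0 < K) (hL : 0 ≤ L) (hc : 0 < c)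
    (hμ : ∀ (x : EuclideanSpace ℝ (Fin n)) (t : ℝ), 0 < t →
        μ (Metric.closedBall x t) ≤ ENNReal.ofReal (L * t)) :
    ∫⁻ x, (∫⁻ t in Ioi (0 : ℝ), ENNReal.ofReal (1 / t ^ 2) *
      ∫⁻ p, (separatedPairs K c x t).indicator
        (fun p => ∫⁻ z, ENNReal.ofReal (curvature p.1 p.2 z ^ 2) ∂μ) p ∂(μ.prod μ)) ∂μ
      ≤ ENNReal.ofReal (2 * L * K ^ 2 / c) * totalCurvatureSq μ := by
  have hQm := measurable_lintegral_curvature μ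
  have hQtot : ∫⁻ p : EuclideanSpace ℝ (Fin n) × EuclideanSpace ℝ (Fin n),
      (∫⁻ z, ENNReal.ofReal (curvature p.1 p.2 z ^ 2) ∂μ) ∂(μ.prod μ) = totalCurvatureSq μ :=
    lintegral_prod _ hQm.aemeasurable
  generalize (fun p : EuclideanSpace ℝ (Fin n) × EuclideanSpace ℝ (Fin n) =>
    ∫⁻ z, ENNReal.ofReal (curvature p.1 p.2 z ^ 2) ∂μ) = Q at hQm hQtot ⊢
  set T : (EuclideanSpace ℝ (Fin n) × ℝ) → (EuclideanSpace ℝ (Fin n) × EuclideanSpace ℝ (Fin n)) →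
    ENNReal := fun w p => ENNReal.ofReal (1 / w.2 ^ 2) * (separatedPairs K c w.1 w.2).indicator 1 p
    with hT
  have hTm : Measurable (Function.uncurry T) := by
    refine Measurable.mul (by fun_prop) ?_
    exact (measurable_one (α := ENNReal)).indicator (measurable_separatedPairs K c)
  have hF : Measurable (Function.uncurry fun w p => T w p * Q p) :=
    hTm.mul (hQm.comp measurable_snd)
  calc _ = ∫⁻ x, (∫⁻ t in Ioi (0 : ℝ), ∫⁻ p, T (x, t) p * Q p ∂(μ.prod μ)) ∂μ := by
        congr with x
        congr with t
        rw [← lintegral_const_mul' _ _ ENNReal.ofReal_ne_top]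
        congr with p
        simp only [hT, mul_assoc]
        congr 1
        by_cases hp : p ∈ separatedPairs K c x t <;> simp [hp]
    _ = ∫⁻ w, ∫⁻ p, T w p * Q p ∂(μ.prod μ) ∂(μ.prod (volume.restrict (Ioi 0))) :=
        (lintegral_prod (fun w => ∫⁻ p, T w p * Q p ∂(μ.prod μ))
          hF.lintegral_prod_right'.aemeasurable).symm
    _ = ∫⁻ p, ∫⁻ w, T w p * Q p ∂(μ.prod (volume.restrict (Ioi 0))) ∂(μ.prod μ) :=
        lintegral_lintegral_swap hF.aemeasurable
    _ ≤ ∫⁻ p, ENNReal.ofReal (2 * L * K ^ 2 / c) * Q p ∂(μ.prod μ) := by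
        refine lintegral_mono fun p => ?_
        have hTp : Measurable fun w => T w p := hTm.of_uncurry_right
        dsimp only
        rw [lintegral_mul_const _ hTp]
        gcongr
        rw [lintegral_prod_symm _ hTp.aemeasurable]
        exact lintegral_separatedPairs_le hK hL hc hμ p
    _ = _ := by rw [lintegral_const_mul _ hQm, hQtot]

lemma density_le_maxDensity (μ : Measure (EuclideanSpace ℝ (Fin n))) {k₀ : ℝ} (hk₀ : 0 ≤ k₀)
    (x : EuclideanSpace ℝ (Fin n)) {t : ℝ} (ht : 0 ≤ t) : density μ x t ≤ maxDensity μ k₀ x t :=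
  le_iSup₂_of_le x (Metric.mem_closedBall_self (mul_nonneg hk₀ ht)) le_rfl

/-- The supremum need not be attained, whence the loss of a factor two. -/
lemma exists_of_le_maxDensity {μ : Measure (EuclideanSpace ℝ (Fin n))} {k₀ δ t : ℝ}
    {x : EuclideanSpace ℝ (Fin n)} (hδ : 0 < δ)
    (h : ENNReal.ofReal δ ≤ maxDensity μ k₀ x t) :
    ∃ y, dist y x ≤ k₀ * t ∧ ENNReal.ofReal (δ / 2 * t) ≤ μ (Metric.closedBall y t) := by
  have h1 : ENNReal.ofReal (δ / 2) < maxDensity μ k₀ x t :=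
    ((ENNReal.ofReal_lt_ofReal_iff hδ).2 (by linarith)).trans_le h
  rw [maxDensity] at h1
  simp only [lt_iSup_iff] at h1
  obtain ⟨y, hy, h2⟩ := h1
  refine ⟨y, hy, ?_⟩
  rw [density] at h2
  rw [ENNReal.ofReal_mul (by positivity)]
  exact ENNReal.mul_le_of_le_div h2.le

end Menger

theorem proposition2p4 (n : ℕ) (C₀ k k₀ δ : ℝ)
    (hC₀ : 10 ≤ C₀) (hk : 1 < k) (hk₀ : 1 ≤ k₀) (hδ : 0 < δ) :
    ∃ C : NNReal, ∀ μ : Measure (EuclideanSpace ℝ (Fin n)),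
      1 ≤ μ (Metric.closedBall 0 2) →
      μ (Metric.closedBall 0 2)ᶜ = 0 →
      (∀ (x : EuclideanSpace ℝ (Fin n)) (t : ℝ), 0 < t →
        μ (Metric.closedBall x t) ≤ ENNReal.ofReal (C₀ * (2 * t))) →
      ((∫⁻ x, (∫⁻ t in Ioi (0 : ℝ),
          {s : ℝ | ENNReal.ofReal δ ≤ Menger.density μ x s}.indicator
            (fun s => Menger.betaOne μ k x s ^ 2 / ENNReal.ofReal s) t) ∂μ)
        ≤ C * Menger.totalCurvatureSq μ) ∧
      ((∫⁻ x, (∫⁻ t in Ioi (0 : ℝ),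
          {s : ℝ | ENNReal.ofReal δ ≤ Menger.maxDensity μ k₀ x s}.indicator
            (fun s => Menger.betaOne μ k x s ^ 2 / ENNReal.ofReal s) t) ∂μ)
        ≤ C * Menger.totalCurvatureSq μ) := by
  have hC0 : 0 < C₀ := by linarith
  have hk0 : 0 < k := by linarith
  -- `K` dominates both `k` and `k₀ + 1`; `c` is chosen so that `L c = η / 2`.
  set K : ℝ := k + k₀ + 1 with hK
  set η : ℝ := δ / 2 with hη
  set c : ℝ := η / (4 * C₀) with hc
  set L : ℝ := 2 * C₀ with hL
  set A : ℝ := 8 * K ^ 4 * (L * k) / η ^ 2 with hA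
  have hKpos : 0 < K := by positivity
  have hηpos : 0 < η := by positivity
  have hcpos : 0 < c := by positivity
  have hLpos : 0 < L := by positivity
  have hApos : 0 < A := by positivity
  refine ⟨Real.toNNReal (A * (2 * L * K ^ 2 / c)), fun μ _ hsupp hμ => ?_⟩
  -- Finiteness provides the s-finiteness that Tonelli requires.
  have : IsFiniteMeasure μ := by
    refine ⟨?_⟩
    rw [← union_compl_self (Metric.closedBall (0 : EuclideanSpace ℝ (Fin n)) 2)]
    refine (measure_union_le _ _).trans_lt ?_
    rw [hsupp, add_zero]
    exact (hμ 0 2 two_pos).trans_lt ENNReal.ofReal_lt_top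
  have hμ' : ∀ (x : EuclideanSpace ℝ (Fin n)) (t : ℝ), 0 < t →
      μ (Metric.closedBall x t) ≤ ENNReal.ofReal (L * t) := fun x t ht =>
    (hμ x t ht).trans_eq (by congr 1; ring)
  have hmax : (∫⁻ x, (∫⁻ t in Ioi (0 : ℝ),
      {s : ℝ | ENNReal.ofReal δ ≤ Menger.maxDensity μ k₀ x s}.indicator
        (fun s => Menger.betaOne μ k x s ^ 2 / ENNReal.ofReal s) t) ∂μ)
      ≤ Real.toNNReal (A * (2 * L * K ^ 2 / c)) * Menger.totalCurvatureSq μ := by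
    have hpt : ∀ x, ∀ t ∈ Ioi (0 : ℝ),
        {s : ℝ | ENNReal.ofReal δ ≤ Menger.maxDensity μ k₀ x s}.indicator
          (fun s => Menger.betaOne μ k x s ^ 2 / ENNReal.ofReal s) t ≤
        ENNReal.ofReal A * (ENNReal.ofReal (1 / t ^ 2) *
          ∫⁻ p, (Menger.separatedPairs K c x t).indicator
            (fun p => ∫⁻ z, ENNReal.ofReal (Menger.curvature p.1 p.2 z ^ 2) ∂μ) p ∂(μ.prod μ)) := by
      intro x t ht
      have ht : 0 < t := ht
      by_cases h : ENNReal.ofReal δ ≤ Menger.maxDensity μ k₀ x t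
      swap
      · rw [indicator_of_notMem (show t ∉ {s : ℝ | _ ≤ Menger.maxDensity μ k₀ x s} from h)]
        exact zero_le
      rw [indicator_of_mem (show t ∈ {s : ℝ | _ ≤ Menger.maxDensity μ k₀ x s} from h)]
      obtain ⟨y, hy, hy'⟩ := Menger.exists_of_le_maxDensity hδ h
      have hb := Menger.betaOne_sq_le (μ := μ) (k := k) (K := K) (M := L * k) (k₀ := k₀) (c := c)
        (η := η) ht (by linarith) (by linarith) hKpos hcpos hηpos
        ((hμ' x (k * t) (by positivity)).trans_eq (by congr 1; ring))
        (fun a => (hμ' a (c * t) (by positivity)).trans_eq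
          (by congr 1; rw [hc, hL]; field_simp; ring)) hy hy'
      refine ENNReal.div_le_of_le_mul (hb.trans_eq ?_)
      have hAt : ENNReal.ofReal (8 * K ^ 4 * (L * k) / η ^ 2 / t) =
          ENNReal.ofReal A * ENNReal.ofReal (1 / t ^ 2) * ENNReal.ofReal t := by
        rw [← hA, ← ENNReal.ofReal_mul hApos.le, ← ENNReal.ofReal_mul (by positivity)]
        congr 1
        field_simp
      rw [hAt]
      ring
    -- Monotonicity of the lower integral needs no measurability of `β₁` or of the density sets.
    calc _ ≤ ∫⁻ x, (∫⁻ t in Ioi (0 : ℝ), ENNReal.ofReal A * (ENNReal.ofReal (1 / t ^ 2) *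
          ∫⁻ p, (Menger.separatedPairs K c x t).indicator
            (fun p => ∫⁻ z, ENNReal.ofReal (Menger.curvature p.1 p.2 z ^ 2) ∂μ) p
              ∂(μ.prod μ))) ∂μ :=
          lintegral_mono fun x => setLIntegral_mono' measurableSet_Ioi (hpt x)
      _ ≤ ENNReal.ofReal A *
          (ENNReal.ofReal (2 * L * K ^ 2 / c) * Menger.totalCurvatureSq μ) := by
          simp_rw [lintegral_const_mul' _ _ (ENNReal.ofReal_ne_top (r := A))]
          gcongr
          exact Menger.lintegral_lintegral_separatedPairs_le hKpos hLpos.le hcpos hμ'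
      _ = _ := by rw [← mul_assoc, ← ENNReal.ofReal_mul hApos.le]; rfl
  refine ⟨le_trans ?_ hmax, hmax⟩
  refine lintegral_mono fun x => setLIntegral_mono' measurableSet_Ioi fun t ht => ?_
  by_cases h : ENNReal.ofReal δ ≤ Menger.density μ x t
  · have h' := h.trans (Menger.density_le_maxDensity μ (zero_le_one.trans hk₀) x (le_of_lt ht))
    rw [indicator_of_mem (show t ∈ {s : ℝ | _ ≤ Menger.density μ x s} from h),
      indicator_of_mem (show t ∈ {s : ℝ | _ ≤ Menger.maxDensity μ k₀ x s} from h')]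
  · rw [indicator_of_notMem (show t ∉ {s : ℝ | _ ≤ Menger.density μ x s} from h)]
    exact zero_le
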